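/- Let $\kappa$ be an uncountable regular cardinal (we work in ZFC). Notation: the space $\kappa^\kappa$ carries the bounded topology, generated by the sets $[\sigma]=\{x\in\kappa^\kappa:\sigma\subseteq x\}$ for $\sigma\in\kappa^{<\kappa}$. A tree is a set $T\subseteq\kappa^{<\kappa}$ closed under initial segments, and $[T]=\{x\in\kappa^\kappa:\forall\alpha<\kappa\ (x{\upharpoonright}\alpha\in T)\}$. The stem of $T$ is the longest node of $T$ that is comparable with all nodes of $T$. A $\kappa$-Laver tree is a tree $T$ that has a stem (in particular $T\neq\varnothing$), is limit-closed (for every limit ordinal $\lambda<\kappa$, the union of any $\subseteq$-increasing sequence of length $\lambda$ of elements of $T$ belongs to $T$), and satisfies $|\{\beta<\kappa:\sigma^\frown\langle\beta\rangle\in T\}|=\kappa$ for every $\sigma\in T$ extending the stem. A set $X\subseteq\kappa^\kappa$ is a strongly dominating family if for every $f:\kappa^{<\kappa}\to\kappa$ there is $x\in X$ with $\exists\alpha_0<\kappa\ \forall\alpha\in(\alpha_0,\kappa)\ (x(\alpha)\ge f(x{\upharpoonright}\alpha))$; $\mathcal D_\kappa$ denotes the ideal of all $X\subseteq\kappa^\kappa$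 that are not strongly dominating families. **Theorem.** There is a closed set $C\subseteq\kappa^\kappa$ such that $C\notin\mathcal D_\kappa$ and $[T]\not\subseteq C$ for every $\kappa$-Laver tree $T$. More explicitly: there are disjoint stationary sets $S_0,S_1\subseteq\kappa$ with $S_0\cup S_1=\{\alpha<\kappa:\mathrm{cf}(\alpha)=\omega\}$, and for any such pair $S_0,S_1$ the set $C=\varphi^{-1}(\{0\})$ has these properties, where $\varphi:\kappa^\kappa\to 2^\kappa$ is given by $\varphi(x)(\alpha)=1\iff\sup\{x(\omega\cdot\alpha+n):n<\omega\}\in S_1$ and $0$ denotes the constant function with value $0$. -/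

import Mathlib

open Cardinal Ordinal Topology

universe u

namespace GenLaver

/-- The cardinal `κ` as the set of all ordinals below it. -/
abbrev Ord (κ : Cardinal.{u}) : Type (u + 1) := Set.Iio κ.ord

/-- The set `κ^κ` of all functions from `κ` to `κ`. -/
abbrev Baire (κ : Cardinal.{u}) : Type (u + 1) := Ord κ → Ord κ

/-- Elements of `κ^{<κ}`: functions from an ordinal `len < κ` to `κ`. -/
structure Node (κ : Cardinal.{u}) where
  len : Ord κ
  val : Set.Iio len → Ord κ

namespace Node

variable {κ : Cardinal.{u}}

/-- A sequence as a set of ordered pairs. -/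
def graph (σ : Node κ) : Set (Ord κ × Ord κ) :=
  {p | ∃ h : p.1 < σ.len, σ.val ⟨p.1, h⟩ = p.2}

/-- `σ ⊆ τ`: the sequence `τ` end-extends `σ` (inclusion of functions as sets of pairs). -/
instance : HasSubset (Node κ) := ⟨fun σ τ => σ.graph ⊆ τ.graph⟩

/-- The basic open set `[σ]` of all `x : κ → κ` that extend `σ`. -/
def cone (σ : Node κ) : Set (Baire κ) :=
  {x | ∀ β : Set.Iio σ.len, x β = σ.val β}

end Node

variable {κ : Cardinal.{u}}

/-- The restriction `x ↾ α`. -/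
def restrict (x : Baire κ) (α : Ord κ) : Node κ := ⟨α, fun β => x β⟩

/-- The bounded topology on `κ^κ`, generated by the sets `[σ]`. -/
abbrev boundedTopology (κ : Cardinal.{u}) : TopologicalSpace (Baire κ) :=
  TopologicalSpace.generateFrom (Set.range (Node.cone (κ := κ)))

/-! ### Trees -/

/-- A tree in `κ^{<κ}`: a set of sequences closed under initial segments. -/
def IsTree (T : Set (Node κ)) : Prop :=
  ∀ τ ∈ T, ∀ σ : Node κ, σ ⊆ τ → σ ∈ T

/-- The set `[T]` of branches of length `κ` through `T`. -/
def branches (T : Set (Node κ)) : Set (Baire κ) :=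
  {x | ∀ α : Ord κ, restrict x α ∈ T}

/-- `T` is limit-closed: the union of every increasing sequence from `T` whose length is a limit
ordinal below `κ` is again in `T`. -/
def IsLimitClosed (T : Set (Node κ)) : Prop :=
  ∀ l : Ord κ, Order.IsSuccLimit (l : Ordinal.{u}) →
    ∀ s : Set.Iio l → Node κ, (∀ a, s a ∈ T) → (∀ a b, a ≤ b → s a ⊆ s b) →
      ∀ σ : Node κ, σ.graph = ⋃ a, (s a).graph → σ ∈ T

/-- `σ` is the stem of `T`: the longest node of `T` that is comparable with every node of `T`. -/
def IsStem (T : Set (Node κ)) (σ : Node κ) : Prop :=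
  (σ ∈ T ∧ ∀ τ ∈ T, σ ⊆ τ ∨ τ ⊆ σ) ∧
    ∀ ρ ∈ T, (∀ τ ∈ T, ρ ⊆ τ ∨ τ ⊆ ρ) → ρ ⊆ σ

/-- `Succ_T(σ)`, the set of all `β < κ` such that `σ ⌢ ⟨β⟩ ∈ T`. -/
def succSet (T : Set (Node κ)) (σ : Node κ) : Set (Ord κ) :=
  {β | ∃ τ ∈ T, σ ⊆ τ ∧ (τ.len : Ordinal.{u}) = σ.len + 1 ∧ (σ.len, β) ∈ τ.graph}

/-- A `κ`-Laver tree: a limit-closed tree that has a stem (in particular, it is not empty) and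
in which every node extending the stem has `κ` many immediate successors. -/
def IsLaverTree (T : Set (Node κ)) : Prop :=
  IsTree T ∧ IsLimitClosed T ∧
    ∃ σ, IsStem T σ ∧ ∀ τ ∈ T, σ ⊆ τ → #(succSet T τ) = Cardinal.lift.{u + 1} κ

/-! ### Strong domination -/

/-- `x` strongly dominates `f : κ^{<κ} → κ`. -/
def StronglyDominates (x : Baire κ) (f : Node κ → Ord κ) : Prop :=
  ∃ α₀ : Ord κ, ∀ α : Ord κ, α₀ < α → f (restrict x α) ≤ x α

/-- `X ⊆ κ^κ` is a strongly dominating family. -/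
def IsStronglyDominating (X : Set (Baire κ)) : Prop :=
  ∀ f : Node κ → Ord κ, ∃ x ∈ X, StronglyDominates x f

/-- The ideal `𝒟_κ` of all sets that are not strongly dominating families. -/
def nonDominatingIdeal (κ : Cardinal.{u}) : Set (Set (Baire κ)) :=
  {X | ¬ IsStronglyDominating X}

/-! ### The coding map -/

/-- `Cof_ω(κ)`, the set of all ordinals below `κ` of cofinality `ω`. -/
def cofOmega (κ : Cardinal.{u}) : Set (Ord κ) := {α | (α : Ordinal.{u}).cof = ℵ₀}

/-- `S₀` and `S₁` are disjoint stationary subsets of `κ` with union `Cof_ω(κ)`. -/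
def IsStationaryPartition (S₀ S₁ : Set (Ord κ)) : Prop :=
  IsStationary S₀ ∧ IsStationary S₁ ∧ Disjoint S₀ S₁ ∧ S₀ ∪ S₁ = cofOmega κ

/-- The set `{x (ω · α + n) : n < ω}` of values of `x` on its block with index `α`. -/
def blockValues (x : Baire κ) (α : Ord κ) : Set (Ord κ) :=
  {y | ∃ (n : ℕ) (γ : Ord κ), (γ : Ordinal.{u}) = Ordinal.omega0.{u} * α + n ∧ x γ = y}

open Classical in
/-- The map `φ : κ^κ → 2^κ` given by `φ(x)(α) = 1 ↔ sup {x (ω · α + n) : n < ω} ∈ S₁`. -/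
noncomputable def blockCode (S₁ : Set (Ord κ)) (x : Baire κ) : Ord κ → Fin 2 :=
  fun α => if ∃ s ∈ S₁, IsLUB (blockValues x α) s then 1 else 0

end GenLaver

/-! Both halves rest on one game, `IsStationary.exists_seq_isLUB_mem`: in ω moves, each taken from
an unbounded set that depends on the earlier moves, the supremum can be steered into any stationary
set S of points of cofinality ω. Fix d in S closed under a choice of next moves, and a sequence `e`
with supremum d; the n-th move is taken between `e n` and d.

`exists_forall_mem_restrict` plays this block by block. Aiming at S₀ with the sets [f(x↾α), κ) gives
a point of C that dominates f; aiming at S₁ with the successor sets of a Laver tree gives a branch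
outside C. C is closed because each block is bounded below κ. The pair S₀, S₁ comes from Fodor's
lemma, applied to one coordinate of chosen ω-sequences converging to the points of cofinality ω. -/

namespace GenLaver

/-! ### Clubs, stationary sets and games of length ω on well-orders -/

section WellOrder

variable {α : Type u} [LinearOrder α]

/-- The points that are suprema of countably many strictly smaller points. -/
def omegaLimits (α : Type u) [LinearOrder α] : Set α :=
  {a | ∃ d : ℕ → α, (∀ n, d n < a) ∧ IsLUB (Set.range d) a}

theorem isClub_Ioi [NoMaxOrder α] (a : α) : IsClub (Set.Ioi a) := by
  refine ⟨fun t ht ⟨b, hb⟩ _ c hc => lt_of_lt_of_le (ht hb) (hc.1 hb), fun b => ?_⟩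
  obtain ⟨c, hc⟩ := exists_gt (max a b)
  exact ⟨c, (le_max_left _ _).trans_lt hc, ((le_max_right _ _).trans_lt hc).le⟩

theorem exists_forall_lt_of_mk_lt_cof {s : Set α} (hs : #s < Order.cof α) : ∃ b, ∀ a ∈ s, a < b := by
  have h : ¬ IsCofinal s := fun h => (Order.cof_le h).not_gt hs
  obtain ⟨b, hb⟩ := not_isCofinal_iff.1 h
  exact ⟨b, hb⟩

theorem noMaxOrder_of_aleph0_lt_cof (hα : ℵ₀ < Order.cof α) : NoMaxOrder α := by
  refine ⟨fun a => ?_⟩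
  obtain ⟨b, hb⟩ := exists_forall_lt_of_mk_lt_cof (s := {a})
    (by simpa using one_lt_aleph0.trans hα)
  exact ⟨b, hb a rfl⟩

theorem exists_forall_lt_of_countable (hα : ℵ₀ < Order.cof α) {ι : Type*} [Countable ι]
    (f : ι → α) : ∃ b, ∀ n, f n < b := by
  obtain ⟨b, hb⟩ := exists_forall_lt_of_mk_lt_cof (s := Set.range f)
    ((le_aleph0_iff_set_countable.2 (Set.countable_range f)).trans_lt hα)
  exact ⟨b, fun n => hb _ ⟨n, rfl⟩⟩

theorem exists_isLUB_range [WellFoundedLT α] (hα : ℵ₀ < Order.cof α) (f : ℕ → α) :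
    ∃ b, IsLUB (Set.range f) b := by
  obtain ⟨b, hb⟩ := exists_forall_lt_of_countable hα f
  obtain ⟨c, hc, hmin⟩ := WellFounded.has_min (wellFounded_lt (α := α))
    (upperBounds (Set.range f)) ⟨b, by rintro _ ⟨n, rfl⟩; exact (hb n).le⟩
  exact ⟨c, hc, fun d hd => not_lt.1 (hmin d hd)⟩

theorem exists_lt_of_forall_mem_lt {t : Set α} {d : α} (hd : IsLUB t d) (ht : t.Nonempty)
    (l : List α) (hl : ∀ a ∈ l, a < d) : ∃ c ∈ t, ∀ a ∈ l, a < c := by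
  induction l with
  | nil => exact ⟨ht.some, ht.some_mem, by simp⟩
  | cons b l ih =>
    obtain ⟨c, hc, hlc⟩ := ih fun a ha => hl a (by simp [ha])
    obtain ⟨e, he, hbe⟩ := (lt_isLUB_iff hd).1 (hl b (by simp))
    rcases le_total c e with h | h
    · exact ⟨e, he, by
        intro a ha
        rcases List.mem_cons.1 ha with rfl | ha
        · exact hbe
        · exact (hlc a ha).trans_le h⟩
    · exact ⟨c, hc, by
        intro a ha
        rcases List.mem_cons.1 ha with rfl | ha
        · exact hbe.trans_le h
        · exact hlc a ha⟩

/-- The points closed under an operation on finite lists form a club. -/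
theorem isClub_closurePoints [WellFoundedLT α] (hα : ℵ₀ < Order.cof α)
    (hsmall : ∀ a : α, #(Set.Iio a) < Order.cof α) (G : List α → α) :
    IsClub {d | ∀ l : List α, (∀ a ∈ l, a < d) → G l < d} := by
  refine ⟨fun t ht htn _ d hd l hl => ?_, fun a => ?_⟩
  · obtain ⟨c, hc, hlc⟩ := exists_lt_of_forall_mem_lt hd htn l hl
    exact (ht hc l hlc).trans_le (hd.1 hc)
  · have key : ∀ b : α, ∃ c, b < c ∧ ∀ l : List α, (∀ a ∈ l, a < b) → G l < c := by
      intro b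
      -- There are at most max(ℵ₀, |b|) finite lists below b, fewer than the cofinality.
      obtain ⟨c, hc⟩ := exists_forall_lt_of_mk_lt_cof
        (s := Set.range fun l : List (Set.Iio b) => G (l.map Subtype.val))
        (mk_range_le.trans_lt ((mk_list_le_max _).trans_lt (max_lt hα (hsmall b))))
      refine ⟨max c (Classical.choose ((noMaxOrder_of_aleph0_lt_cof hα).exists_gt b)),
        lt_max_of_lt_right
          (Classical.choose_spec ((noMaxOrder_of_aleph0_lt_cof hα).exists_gt b)), ?_⟩
      intro l hl
      refine lt_max_of_lt_left (hc _ ⟨l.attach.map fun a => ⟨a.1, hl a.1 a.2⟩, ?_⟩)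
      simp
    choose h hlt hG using key
    let s : ℕ → α := fun n => h^[n] a
    have hs : ∀ n, s (n + 1) = h (s n) := fun n => Function.iterate_succ_apply' h n a
    obtain ⟨d, hd⟩ := exists_isLUB_range hα s
    refine ⟨d, fun l hl => ?_, hd.1 ⟨0, rfl⟩⟩
    obtain ⟨_, ⟨n, rfl⟩, hn⟩ := exists_lt_of_forall_mem_lt hd (Set.range_nonempty s) l hl
    exact (hG (s n) l hn).trans_le (hs n ▸ hd.1 ⟨n + 1, rfl⟩)

/-- **Fodor's lemma**: a regressive function on a stationary set is constant on a stationary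
subset. -/
theorem _root_.IsStationary.exists_isStationary_fiber [WellFoundedLT α] (hα : ℵ₀ < Order.cof α)
    (hsmall : ∀ a : α, #(Set.Iio a) < Order.cof α) {S : Set α} (hS : IsStationary S) (f : α → α)
    (hf : ∀ a ∈ S, f a < a) : ∃ c, IsStationary {a ∈ S | f a = c} := by
  by_contra! hcon
  simp_rw [not_isStationary_iff] at hcon
  choose C hC hdisj using hcon
  have := noMaxOrder_of_aleph0_lt_cof hα
  have hnext : ∀ c b, ∃ e, b < e ∧ e ∈ C c := fun c b => by
    obtain ⟨b', hb'⟩ := exists_gt b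
    obtain ⟨e, he, hbe⟩ := (hC c).isCofinal b'
    exact ⟨e, hb'.trans_le hbe, he⟩
  choose next hlt hmem using hnext
  have a₀ := hS.nonempty.some
  -- A list codes the pair (head, last), so d is closed under the binary `next`; this replaces a
  -- diagonal intersection.
  obtain ⟨d, hdS, hd⟩ := hS (isClub_closurePoints hα hsmall
    fun l => next (l.headD a₀) (l.getLastD a₀))
  have hcl : ∀ c < d, ∀ b < d, next c b < d := fun c hc b hb => by
    simpa using hd [c, b] (by simp [hc, hb])
  have hdC : d ∈ C (f d) := by
    refine (hC (f d)).isLUB_mem (t := {e | e ∈ C (f d) ∧ e < d}) (fun e he => he.1)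
      ⟨next (f d) (f d), hmem _ _, hcl _ (hf d hdS) _ (hf d hdS)⟩ ⟨fun e he => he.2.le, ?_⟩
    intro b hb
    by_contra! hbd
    exact (hlt (f d) b).not_ge (hb ⟨hmem _ _, hcl _ (hf d hdS) _ hbd⟩)
  exact Set.disjoint_left.1 (hdisj (f d)) ⟨hdS, rfl⟩ hdC

theorem isStationary_omegaLimits [WellFoundedLT α] (hα : ℵ₀ < Order.cof α) :
    IsStationary (omegaLimits α) := by
  intro C hC
  have := noMaxOrder_of_aleph0_lt_cof hα
  have : Nonempty α := Order.cof_ne_zero_iff.1 (aleph0_pos.trans hα).ne'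
  have hnext : ∀ b, ∃ e, b < e ∧ e ∈ C := fun b => by
    obtain ⟨b', hb'⟩ := exists_gt b
    obtain ⟨e, he, hbe⟩ := hC.isCofinal b'
    exact ⟨e, hb'.trans_le hbe, he⟩
  choose h hlt hmem using hnext
  -- The exponent starts at 1 because the starting point need not lie in C.
  let s : ℕ → α := fun n => h^[n + 1] (Classical.arbitrary α)
  have hs : ∀ n, s (n + 1) = h (s n) := fun n => Function.iterate_succ_apply' h _ _
  obtain ⟨d, hd⟩ := exists_isLUB_range hα s
  refine ⟨d, ⟨s, fun n => ?_, hd⟩, hC.isLUB_mem ?_ (Set.range_nonempty s) hd⟩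
  · exact (hs n ▸ hlt (s n) : s n < s (n + 1)).trans_le (hd.1 ⟨n + 1, rfl⟩)
  · rintro _ ⟨n, rfl⟩
    simpa only [s, Function.iterate_succ_apply'] using hmem _

/-- A stationary set of points of countable cofinality contains two disjoint stationary sets. -/
theorem _root_.IsStationary.exists_isStationary_diff [WellFoundedLT α] (hα : ℵ₀ < Order.cof α)
    (hsmall : ∀ a : α, #(Set.Iio a) < Order.cof α) {S : Set α} (hS : IsStationary S)
    (hSω : S ⊆ omegaLimits α) : ∃ A ⊆ S, IsStationary A ∧ IsStationary (S \ A) := by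
  have := noMaxOrder_of_aleph0_lt_cof hα
  have hd : ∀ a : α, ∃ d : ℕ → α, a ∈ S → (∀ n, d n < a) ∧ IsLUB (Set.range d) a := fun a => by
    by_cases ha : a ∈ S
    · obtain ⟨d, hd⟩ := hSω ha
      exact ⟨d, fun _ => hd⟩
    · exact ⟨fun _ => a, fun h => (ha h).elim⟩
  choose d hd using hd
  -- Otherwise each n has a bound `b n` and a club avoiding the set; a point of S in all these clubs
  -- and above all `b n` would be the supremum of a sequence whose n-th term stays below `b n`.
  have hn : ∃ n, ∀ b, IsStationary {a ∈ S | b ≤ d a n} := by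
    by_contra! hcon
    choose b hb using hcon
    simp_rw [not_isStationary_iff] at hb
    choose C hC hdisj using hb
    obtain ⟨c, hc⟩ := exists_forall_lt_of_countable hα b
    obtain ⟨a, haS, haC, hca⟩ := hS ((IsClub.iInter_of_countable hα.ne' hC).inter hα.ne'
      (isClub_Ioi c))
    obtain ⟨_, ⟨n, rfl⟩, hn⟩ := (lt_isLUB_iff (hd a haS).2).1 hca
    exact Set.disjoint_left.1 (hdisj n) ⟨haS, ((hc n).trans hn).le⟩ (Set.mem_iInter.1 haC n)
  obtain ⟨n, hn⟩ := hn
  -- Fodor's lemma gives stationary fibers over arbitrarily large values; two distinct values give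
  -- disjoint fibers.
  have hfib : ∀ b, ∃ c ≥ b, IsStationary {a ∈ S | d a n = c} := fun b => by
    obtain ⟨c, hc⟩ := (hn b).exists_isStationary_fiber hα hsmall (fun a => d a n)
      fun a ha => (hd a ha.1).1 n
    obtain ⟨a, ⟨-, hba⟩, rfl⟩ := hc.nonempty
    exact ⟨_, hba, hc.mono fun a ha => ⟨ha.1.1, ha.2⟩⟩
  obtain ⟨c, -, hc⟩ := hfib hS.nonempty.some
  obtain ⟨b, hb⟩ := exists_gt c
  obtain ⟨e, he, hes⟩ := hfib b
  refine ⟨_, Set.sep_subset _ _, hc, hes.mono fun a ha => ⟨ha.1, fun h => ?_⟩⟩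
  exact (hb.trans_le he).ne (h.2.symm.trans ha.2)

theorem exists_seq_mem {α : Type*} (A : List α → Set α) (hA : ∀ l, (A l).Nonempty) :
    ∃ s : ℕ → α, ∀ n, s n ∈ A ((List.range n).map s) := by
  choose g hg using hA
  let L : ℕ → List α := fun n => Nat.rec [] (fun _ l => l ++ [g l]) n
  refine ⟨fun n => g (L n), fun n => ?_⟩
  have : (List.range n).map (fun n => g (L n)) = L n := by
    induction n with
    | zero => rfl
    | succ n ih => rw [List.range_succ, List.map_append, ih]; rfl
  rw [this]
  exact hg _

/-- In the game of length `ω` in which unbounded sets are prescribed along the play, the supremum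
of the play can be steered into any stationary set of points of countable cofinality. -/
theorem _root_.IsStationary.exists_seq_isLUB_mem [WellFoundedLT α] (hα : ℵ₀ < Order.cof α)
    (hsmall : ∀ a : α, #(Set.Iio a) < Order.cof α) {S : Set α} (hS : IsStationary S)
    (hSω : S ⊆ omegaLimits α) (A : List α → Set α) (hA : ∀ l, IsCofinal (A l)) :
    ∃ s : ℕ → α, (∀ n, s n ∈ A ((List.range n).map s)) ∧ ∃ d ∈ S, IsLUB (Set.range s) d := by
  choose next hmem hle using hA
  have a₀ := hS.nonempty.some
  -- The head of the list is the lower bound for the next move, the tail is the play so far.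
  obtain ⟨d, hdS, hd⟩ := hS (isClub_closurePoints hα hsmall fun l => next l.tail (l.headD a₀))
  obtain ⟨e, hed, he⟩ := hSω hdS
  -- The premise that the play stays below d makes the set nonempty for every list; it is discharged
  -- by induction in `hsd`.
  obtain ⟨s, hs⟩ := exists_seq_mem (fun l => {b | (∀ a ∈ l, a < d) →
      b ∈ A l ∧ e l.length ≤ b ∧ b < d}) fun l => by
    refine ⟨next l (e l.length), fun hl => ⟨hmem _ _, hle _ _, ?_⟩⟩
    refine hd (e l.length :: l) fun a ha => ?_
    rcases List.mem_cons.1 ha with rfl | ha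
    · exact hed _
    · exact hl a ha
  have hsd : ∀ n, s n < d := fun n => by
    induction n using Nat.strong_induction_on with
    | _ n ih =>
      refine (hs n ?_).2.2
      simpa using ih
  have hs' : ∀ n, s n ∈ A ((List.range n).map s) ∧ e n ≤ s n := fun n => by
    obtain ⟨h₁, h₂, -⟩ := hs n (by simpa using fun m _ => hsd m)
    exact ⟨h₁, by simpa using h₂⟩
  refine ⟨s, fun n => (hs' n).1, d, hdS, ?_, fun b hb => he.2 ?_⟩
  · rintro _ ⟨n, rfl⟩
    exact (hsd n).le
  · rintro _ ⟨n, rfl⟩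
    exact (hs' n).2.trans (hb ⟨n, rfl⟩)

end WellOrder

/-! ### Regular cardinals and the construction along blocks of length ω -/

section RegularCardinal

variable {κ : Cardinal.{u}}

theorem cof_ord_type (hκ : κ.IsRegular) : Order.cof (Ord κ) = Cardinal.lift.{u + 1} κ := by
  rw [Ordinal.cof_Iio, ← Ordinal.lift_cof, hκ.cof_ord]

theorem aleph0_lt_cof_ord_type (hκ : κ.IsRegular) (hunc : ℵ₀ < κ) : ℵ₀ < Order.cof (Ord κ) := by
  rw [cof_ord_type hκ]
  simpa using hunc

theorem mk_Iio_ord_lt_lift (a : Ord κ) : #(Set.Iio a) < Cardinal.lift.{u + 1} κ := by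
  have h : #(Set.Iio a) ≤ #(Set.Iio (a : Ordinal.{u})) :=
    mk_le_of_injective (f := fun b => ⟨b.1.1, b.2⟩) fun b c h =>
      Subtype.ext (Subtype.ext (congrArg (fun z => z.1) h))
  refine h.trans_lt ?_
  rw [Cardinal.mk_Iio_ordinal, Cardinal.lift_lt]
  exact lt_ord.1 a.2

theorem cofOmega_eq_omegaLimits : cofOmega κ = omegaLimits (Ord κ) := by
  ext a
  constructor
  · intro ha
    have ha' : (a : Ordinal.{u}).cof.ord = ω := by
      rw [show (a : Ordinal.{u}).cof = ℵ₀ from ha, ord_aleph0]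
    obtain ⟨f, hf⟩ := exists_isFundamentalSeq ha'
    have hlt : ∀ n : ℕ, (f ⟨n, natCast_lt_omega0 n⟩ : Ordinal.{u}) < a := fun n => (f _).2
    refine ⟨fun n => ⟨f ⟨n, natCast_lt_omega0 n⟩, (hlt n).trans a.2⟩, hlt, ?_, ?_⟩
    · rintro _ ⟨n, rfl⟩
      exact (hlt n).le
    · intro b hb
      by_contra! hba
      have hlim : Order.IsSuccLimit (a : Ordinal.{u}) := by
        rw [← Ordinal.one_lt_cof_iff, show (a : Ordinal.{u}).cof = ℵ₀ from ha]
        exact one_lt_aleph0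
      -- The successor is needed because cofinality of the range yields only ≤.
      have hb1 : Order.succ (b : Ordinal.{u}) < a := hlim.succ_lt hba
      obtain ⟨_, ⟨⟨i, hi⟩, rfl⟩, hc⟩ := hf.isCofinal_range ⟨_, hb1⟩
      obtain ⟨n, rfl⟩ := lt_omega0.1 hi
      exact (Order.succ_le_iff.1 (show Order.succ (b : Ordinal.{u}) ≤ _ from hc)).not_ge (hb ⟨n, rfl⟩)
  · rintro ⟨d, hda, hd⟩
    refine le_antisymm ?_ ?_
    · have h := Ordinal.cof_Iio (a : Ordinal.{u})
      have hcof : IsCofinal (Set.range fun n => (⟨d n, hda n⟩ : Set.Iio (a : Ordinal.{u}))) := by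
        rintro ⟨b, hb⟩
        obtain ⟨_, ⟨n, rfl⟩, hn⟩ := (lt_isLUB_iff hd).1
          (show (⟨b, lt_trans (b := (a : Ordinal.{u})) hb a.2⟩ : Ord κ) < a from hb)
        exact ⟨_, ⟨n, rfl⟩, le_of_lt hn⟩
      have h2 := (Order.cof_le hcof).trans
        (le_aleph0_iff_set_countable.2 (Set.countable_range _))
      rw [h, ← Ordinal.lift_cof, Cardinal.lift_le_aleph0] at h2
      exact h2
    · rw [Ordinal.aleph0_le_cof_iff, Ordinal.one_lt_cof_iff, Ordinal.isSuccLimit_iff]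
      refine ⟨fun h => ?_, ?_⟩
      · have := hda 0
        rw [← Subtype.coe_lt_coe, h] at this
        exact not_lt_bot this
      · rw [Order.isSuccPrelimit_iff_succ_lt]
        intro b hb
        obtain ⟨_, ⟨n, rfl⟩, hn⟩ := (lt_isLUB_iff hd).1
          (show (⟨b, lt_trans (b := (a : Ordinal.{u})) hb a.2⟩ : Ord κ) < a from hb)
        exact (Order.succ_le_of_lt (show b < (d n : Ordinal.{u}) from hn)).trans_lt (hda n)

theorem exists_isStationaryPartition (hκ : κ.IsRegular) (hunc : ℵ₀ < κ) :
    ∃ S₀ S₁ : Set (Ord κ), IsStationaryPartition S₀ S₁ := by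
  have hα := aleph0_lt_cof_ord_type hκ hunc
  obtain ⟨A, hA, hA₀, hA₁⟩ := (isStationary_omegaLimits hα).exists_isStationary_diff hα
    (fun a => cof_ord_type hκ ▸ mk_Iio_ord_lt_lift a) subset_rfl
  exact ⟨A, _, hA₀, hA₁, Set.disjoint_sdiff_right,
    (Set.union_sdiff_cancel hA).trans cofOmega_eq_omegaLimits.symm⟩

/-- The ordinal `a + n` as an element of an infinite cardinal. -/
def addNat (hκ : ℵ₀ ≤ κ) (a : Ord κ) (n : ℕ) : Ord κ :=
  ⟨a + n, isPrincipal_add_ord hκ a.2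
    ((natCast_lt_omega0 n).trans_le (ord_aleph0 ▸ ord_le_ord.2 hκ))⟩

theorem le_addNat (hκ : ℵ₀ ≤ κ) (a : Ord κ) (n : ℕ) : a ≤ addNat hκ a n :=
  le_self_add (a := (a : Ordinal.{u}))

/-- The first position `ω · a` of the block with index `a`. -/
def blockStart (hκ : ℵ₀ < κ) (a : Ord κ) : Ord κ :=
  ⟨ω * a, isPrincipal_mul_ord hκ.le (ord_aleph0 ▸ ord_lt_ord.2 hκ) a.2⟩

theorem blockValues_eq_range (hκ : ℵ₀ < κ) (x : Baire κ) (a : Ord κ) :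
    blockValues x a = Set.range fun n => x (addNat hκ.le (blockStart hκ a) n) := by
  ext y
  constructor
  · rintro ⟨n, γ, hγ, rfl⟩
    exact ⟨n, congrArg x (Subtype.ext hγ.symm)⟩
  · rintro ⟨n, rfl⟩
    exact ⟨n, _, rfl, rfl⟩

theorem restrict_congr {x y : Baire κ} {a : Ord κ} (h : ∀ b < a, x b = y b) :
    restrict x a = restrict y a := by
  unfold restrict
  congr 1
  funext b
  exact h b b.2

/-- The function that extends the sequence `σ` by the values of `s`. -/
noncomputable def Node.extend (σ : Node κ) (s : ℕ → Ord κ) : Baire κ := fun b =>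
  if h : b < σ.len then σ.val ⟨b, h⟩
  -- From `σ.len + ω` on this is the junk value `s 0`.
  else s (Cardinal.toNat ((b : Ordinal.{u}) - (σ.len : Ordinal.{u})).card)

theorem Node.extend_of_lt (σ : Node κ) (s : ℕ → Ord κ) {b : Ord κ} (h : b < σ.len) :
    σ.extend s b = σ.val ⟨b, h⟩ := dif_pos h

theorem Node.extend_addNat (hκ : ℵ₀ ≤ κ) (σ : Node κ) (s : ℕ → Ord κ) (n : ℕ) :
    σ.extend s (addNat hκ σ.len n) = s n := by
  have h : ¬ addNat hκ σ.len n < σ.len := not_lt.2 (le_addNat hκ _ _)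
  rw [Node.extend, dif_neg h]
  simp [addNat]

theorem lt_addNat_iff (hκ : ℵ₀ ≤ κ) {a b : Ord κ} {n : ℕ} :
    b < addNat hκ a n ↔ b < a ∨ ∃ m < n, b = addNat hκ a m := by
  constructor
  · intro h
    refine or_iff_not_imp_left.2 fun hba => ?_
    have hab : (a : Ordinal.{u}) ≤ b := not_lt.1 hba
    have hlt : (b : Ordinal.{u}) - a < n := by
      rw [Ordinal.sub_lt_of_le hab]
      exact h
    obtain ⟨m, hm⟩ := lt_omega0.1 (hlt.trans (natCast_lt_omega0 n))
    refine ⟨m, by rw [hm] at hlt; exact_mod_cast hlt, Subtype.ext ?_⟩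
    show (b : Ordinal.{u}) = a + m
    rw [← hm, Ordinal.add_sub_cancel_of_le hab]
  · rintro (h | ⟨m, hm, rfl⟩)
    · exact h.trans_le (le_addNat hκ _ _)
    · show (a : Ordinal.{u}) + m < a + n
      exact (add_lt_add_iff_left _).2 (by exact_mod_cast hm)

/-- The game on a single block. The supremum clause is conditional because sets prescribed inside a
stem are singletons, where the values can only be met. -/
theorem Node.exists_extend (hκ : κ.IsRegular) (hunc : ℵ₀ < κ) {S : Set (Ord κ)}
    (hS : IsStationary S) (hSω : S ⊆ cofOmega κ) (A : Node κ → Set (Ord κ))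
    (hA : ∀ σ, (A σ).Nonempty) (σ : Node κ) :
    ∃ s : ℕ → Ord κ, (∀ n, s n ∈ A (restrict (σ.extend s) (addNat hunc.le σ.len n))) ∧
      ((∀ τ : Node κ, σ.len ≤ τ.len → IsCofinal (A τ)) → ∃ d ∈ S, IsLUB (Set.range s) d) := by
  have hα := aleph0_lt_cof_ord_type hκ hunc
  obtain ⟨z⟩ := hS.nonempty.to_type
  -- The padding by z is invisible, since the restriction stops after `l.length` entries.
  let A' : List (Ord κ) → Set (Ord κ) := fun l =>
    A (restrict (σ.extend fun n => l.getD n z) (addNat hunc.le σ.len l.length))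
  have key : ∀ s : ℕ → Ord κ, (∀ n, s n ∈ A' ((List.range n).map s)) →
      ∀ n, s n ∈ A (restrict (σ.extend s) (addNat hunc.le σ.len n)) := fun s hs n => by
    have h := hs n
    simp only [A', List.length_map, List.length_range] at h
    rwa [restrict_congr (y := σ.extend s)] at h
    intro b hb
    rcases (lt_addNat_iff _).1 hb with hb | ⟨m, hm, rfl⟩
    · rw [σ.extend_of_lt _ hb, σ.extend_of_lt _ hb]
    · rw [σ.extend_addNat, σ.extend_addNat]
      simp [hm]
  by_cases hcof : ∀ τ : Node κ, σ.len ≤ τ.len → IsCofinal (A τ)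
  · obtain ⟨s, hs, hd⟩ := hS.exists_seq_isLUB_mem hα
      (fun a => cof_ord_type hκ ▸ mk_Iio_ord_lt_lift a) (cofOmega_eq_omegaLimits ▸ hSω) A'
      fun l => hcof _ (le_addNat hunc.le _ _)
    exact ⟨s, key s hs, fun _ => hd⟩
  · obtain ⟨s, hs⟩ := exists_seq_mem A' fun l => hA _
    exact ⟨s, key s hs, fun h => (hcof h).elim⟩

/-- Sets prescribed along a function `κ → κ` can be met at every position such that the supremum of
each block on which these sets are unbounded lies in a given stationary set. -/
theorem exists_forall_mem_restrict (hκ : κ.IsRegular) (hunc : ℵ₀ < κ) {S : Set (Ord κ)}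
    (hS : IsStationary S) (hSω : S ⊆ cofOmega κ) (A : Node κ → Set (Ord κ))
    (hA : ∀ σ, (A σ).Nonempty) :
    ∃ x : Baire κ, (∀ c, x c ∈ A (restrict x c)) ∧ ∀ a : Ord κ,
      (∀ τ : Node κ, blockStart hunc a ≤ τ.len → IsCofinal (A τ)) →
        ∃ d ∈ S, IsLUB (blockValues x a) d := by
  choose s hs hlub using Node.exists_extend hκ hunc hS hSω A hA
  let q : Ord κ → Ord κ := fun c =>
    ⟨(c : Ordinal.{u}) / ω, lt_of_le_of_lt (b := (c : Ordinal.{u})) 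
      ((Ordinal.le_mul_right _ omega0_pos).trans (Ordinal.mul_div_le _ _)) c.2⟩
  have hq : ∀ c, blockStart hunc (q c) ≤ c := fun c => Ordinal.mul_div_le _ _
  -- The entry at c is read off, at place c % ω, from the play chosen for x restricted to the start
  -- of its block; thus all entries of a block come from the same play.
  let F : (c : Ord κ) → ((b : Ord κ) → b < c → Ord κ) → Ord κ := fun c ih =>
    s ⟨blockStart hunc (q c), fun b => ih b (b.2.trans_le (hq c))⟩
      (Cardinal.toNat ((c : Ordinal.{u}) % ω).card)
  let x : Baire κ := (wellFounded_lt (α := Ord κ)).fix F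
  have hx : ∀ a n, x (addNat hunc.le (blockStart hunc a) n) =
      s (restrict x (blockStart hunc a)) n := fun a n => by
    have hqa : q (addNat hunc.le (blockStart hunc a) n) = a := by
      refine Subtype.ext ?_
      show (ω * (a : Ordinal.{u}) + n) / ω = a
      rw [Ordinal.mul_add_div _ omega0_ne_zero, Ordinal.div_eq_zero_of_lt (natCast_lt_omega0 n),
        add_zero]
    have hmod : Cardinal.toNat
        ((addNat hunc.le (blockStart hunc a) n : Ordinal.{u}) % ω).card = n := by
      show Cardinal.toNat ((ω * (a : Ordinal.{u}) + n) % ω).card = n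
      rw [Ordinal.mul_add_mod_self, Ordinal.mod_eq_of_lt (natCast_lt_omega0 n)]
      simp
    have h : x (addNat hunc.le (blockStart hunc a) n) = s
        (restrict x (blockStart hunc (q (addNat hunc.le (blockStart hunc a) n))))
        (Cardinal.toNat ((addNat hunc.le (blockStart hunc a) n : Ordinal.{u}) % ω).card) :=
      (wellFounded_lt (α := Ord κ)).fix_eq F _
    rw [h, hqa, hmod]
  have hext : ∀ a n, restrict x (addNat hunc.le (blockStart hunc a) n) =
      restrict ((restrict x (blockStart hunc a)).extend (s (restrict x (blockStart hunc a))))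
        (addNat hunc.le (blockStart hunc a) n) := fun a n => by
    refine restrict_congr fun b hb => ?_
    rcases (lt_addNat_iff _).1 hb with hb | ⟨m, hm, rfl⟩
    · rw [Node.extend_of_lt _ _ (show b < (restrict x (blockStart hunc a)).len from hb)]
      rfl
    · rw [hx]
      exact (Node.extend_addNat hunc.le (restrict x (blockStart hunc a)) _ m).symm
  refine ⟨x, fun c => ?_, fun a ha => ?_⟩
  · obtain ⟨n, hn⟩ := lt_omega0.1 (Ordinal.mod_lt (c : Ordinal.{u}) omega0_ne_zero)
    have hc : c = addNat hunc.le (blockStart hunc (q c)) n := by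
      refine Subtype.ext ?_
      show (c : Ordinal.{u}) = ω * (c / ω) + n
      rw [← hn, Ordinal.div_add_mod]
    rw [hc, hx, hext]
    exact hs _ n
  · rw [blockValues_eq_range hunc]
    simp_rw [hx]
    exact hlub _ ha

end RegularCardinal

/-! ### The closed set and its relation to Laver trees -/

section Trees

variable {κ : Cardinal.{u}}

theorem blockCode_eq_zero_iff {S₁ : Set (Ord κ)} {x : Baire κ} {a : Ord κ} :
    blockCode S₁ x a = 0 ↔ ¬ ∃ s ∈ S₁, IsLUB (blockValues x a) s := by
  unfold blockCode
  split_ifs with h <;> simp [h]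

theorem mem_preimage_blockCode_iff {S₁ : Set (Ord κ)} {x : Baire κ} :
    x ∈ blockCode S₁ ⁻¹' {fun _ => 0} ↔
      ∀ a, ¬ ∃ s ∈ S₁, IsLUB (blockValues x a) s := by
  simp only [Set.mem_preimage, Set.mem_singleton_iff, funext_iff, blockCode_eq_zero_iff]

theorem isClosed_preimage_blockCode (hκ : κ.IsRegular) (hunc : ℵ₀ < κ) (S₁ : Set (Ord κ)) :
    IsClosed[boundedTopology κ] (blockCode S₁ ⁻¹' {fun _ => 0}) := by
  let _ : TopologicalSpace (Baire κ) := boundedTopology κ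
  rw [← isOpen_compl_iff, isOpen_iff_forall_mem_open]
  intro x hx
  rw [Set.mem_compl_iff, mem_preimage_blockCode_iff] at hx
  push Not at hx
  obtain ⟨a, s, hs, hlub⟩ := hx
  -- The block is countable, hence bounded by some c < κ, and x↾c decides its supremum.
  obtain ⟨c, hc⟩ := exists_forall_lt_of_countable (aleph0_lt_cof_ord_type hκ hunc)
    fun n => addNat hunc.le (blockStart hunc a) n
  refine ⟨(restrict x c).cone, fun y hy => ?_,
    TopologicalSpace.isOpen_generateFrom_of_mem ⟨_, rfl⟩, fun _ => rfl⟩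
  rw [Set.mem_compl_iff, mem_preimage_blockCode_iff]
  push Not
  refine ⟨a, s, hs, ?_⟩
  rw [blockValues_eq_range hunc] at hlub ⊢
  rwa [funext fun n => show y _ = x _ from hy ⟨_, hc n⟩]

theorem isCofinal_Ici {α : Type*} [LinearOrder α] (a : α) : IsCofinal (Set.Ici a) :=
  fun b => ⟨max a b, le_max_left _ _, le_max_right _ _⟩

theorem isStronglyDominating_preimage_blockCode (hκ : κ.IsRegular) (hunc : ℵ₀ < κ)
    {S₀ S₁ : Set (Ord κ)} (hS : IsStationaryPartition S₀ S₁) :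
    IsStronglyDominating (blockCode S₁ ⁻¹' {fun _ => 0}) := by
  intro f
  obtain ⟨x, hx, hlub⟩ := exists_forall_mem_restrict hκ hunc hS.1
    (hS.2.2.2 ▸ Set.subset_union_left) (fun σ => Set.Ici (f σ)) fun σ => Set.nonempty_Ici
  -- Domination holds at every position, so any threshold serves.
  refine ⟨x, mem_preimage_blockCode_iff.2 ?_, hS.1.nonempty.some, fun a _ => hx a⟩
  rintro a ⟨s, hs, hsl⟩
  obtain ⟨d, hd, hdl⟩ := hlub a fun τ _ => isCofinal_Ici _
  exact Set.disjoint_left.1 hS.2.2.1 hd (hsl.unique hdl ▸ hs)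

theorem graph_restrict (x : Baire κ) (a : Ord κ) :
    (restrict x a).graph = {p | p.1 < a ∧ x p.1 = p.2} := by
  ext p
  exact ⟨fun ⟨h, hp⟩ => ⟨h, hp⟩, fun ⟨h, hp⟩ => ⟨h, hp⟩⟩

theorem restrict_subset_iff {x : Baire κ} {a : Ord κ} {τ : Node κ} :
    restrict x a ⊆ τ ↔ ∀ b < a, (b, x b) ∈ τ.graph := by
  constructor
  · exact fun h b hb => h ⟨hb, rfl⟩
  · rintro h ⟨b, c⟩ ⟨hb, hc⟩
    obtain rfl : x b = c := hc
    exact h b hb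

theorem subset_restrict_of_forall_eq {ρ : Node κ} {x : Baire κ} {a : Ord κ} (ha : ρ.len ≤ a)
    (h : ∀ b : Set.Iio ρ.len, x b = ρ.val b) : ρ ⊆ restrict x a := by
  rintro ⟨b, c⟩ ⟨hb, hc⟩
  exact ⟨lt_of_lt_of_le hb ha, (h ⟨b, hb⟩).trans hc⟩

theorem isCofinal_of_mk_eq {s : Set (Ord κ)} (hs : #s = Cardinal.lift.{u + 1} κ) :
    IsCofinal s := by
  by_contra h
  obtain ⟨b, hb⟩ := not_isCofinal_iff.1 h
  exact ((mk_le_mk_of_subset (show s ⊆ Set.Iio b from hb)).trans_lt (mk_Iio_ord_lt_lift b)).ne hs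

/-- A function that extends the stem `ρ` and takes its further values in the successor sets of the
Laver tree `T` is a branch of `T`. -/
theorem mem_branches_of_forall_mem_succSet {T : Set (Node κ)} (hT : IsTree T)
    (hlim : IsLimitClosed T) {ρ : Node κ} (hρ : ρ ∈ T) {x : Baire κ}
    (hstem : ∀ b : Set.Iio ρ.len, x b = ρ.val b)
    (hsucc : ∀ c, ρ.len ≤ c → restrict x c ∈ T → x c ∈ succSet T (restrict x c)) :
    x ∈ branches T := by
  intro c
  induction c using WellFoundedLT.induction with
  | _ c ih =>
  rcases le_total c ρ.len with hc | hc
  · refine hT ρ hρ _ (restrict_subset_iff.2 fun b hb => ?_)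
    exact ⟨hb.trans_le hc, (hstem ⟨b, hb.trans_le hc⟩).symm⟩
  rcases Ordinal.zero_or_succ_or_isSuccLimit (c : Ordinal.{u}) with h0 | ⟨b, hb⟩ | hl
  · refine hT ρ hρ _ (restrict_subset_iff.2 fun b hb => ?_)
    rw [← Subtype.coe_lt_coe, h0] at hb
    exact (not_lt_bot hb).elim
  · have hbc : b < c := hb ▸ Order.lt_succ b
    obtain ⟨b, rfl⟩ : ∃ b' : Ord κ, b = b' :=
      ⟨⟨b, lt_trans (b := (c : Ordinal.{u})) hbc c.2⟩, rfl⟩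
    rcases lt_or_ge b ρ.len with hbρ | hbρ
    · have hcρ : c ≤ ρ.len := show (c : Ordinal.{u}) ≤ _ from hb ▸ Order.succ_le_of_lt hbρ
      refine hT ρ hρ _ (restrict_subset_iff.2 fun b hb => ?_)
      exact ⟨hb.trans_le hcρ, (hstem ⟨b, hb.trans_le hcρ⟩).symm⟩
    · obtain ⟨τ, hτ, hsub, -, hg⟩ := hsucc b hbρ (ih b hbc)
      refine hT τ hτ _ (restrict_subset_iff.2 fun e he => ?_)
      have heb : e ≤ b := 
        show (e : Ordinal.{u}) ≤ b from
          Order.lt_succ_iff.1 (show (e : Ordinal.{u}) < Order.succ (b : Ordinal.{u}) from hb ▸ he)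
      rcases heb.lt_or_eq with h | rfl
      · exact restrict_subset_iff.1 hsub e h
      · exact hg
  · refine hlim c hl (fun a => restrict x a) (fun a => ih a a.2) (fun a b hab => ?_) _ ?_
    · exact restrict_subset_iff.2 fun e he => ⟨lt_of_lt_of_le he hab, rfl⟩
    · ext ⟨e, y⟩
      simp only [graph_restrict, Set.mem_iUnion, Set.mem_ofPred_eq]
      constructor
      · rintro ⟨he, hy⟩
        have : Order.succ (e : Ordinal.{u}) < c := hl.succ_lt he
        exact ⟨⟨⟨_, lt_trans (b := (c : Ordinal.{u})) this c.2⟩, this⟩,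
          Order.lt_succ (e : Ordinal.{u}), hy⟩
      · rintro ⟨a, he, hy⟩
        exact ⟨he.trans a.2, hy⟩

theorem not_branches_subset_preimage_blockCode (hκ : κ.IsRegular) (hunc : ℵ₀ < κ)
    {S₀ S₁ : Set (Ord κ)} (hS : IsStationaryPartition S₀ S₁) {T : Set (Node κ)}
    (hT : IsLaverTree T) : ¬ branches T ⊆ blockCode S₁ ⁻¹' {fun _ => 0} := by
  obtain ⟨hT, hlim, ρ, ⟨⟨hρ, -⟩, -⟩, hsucc⟩ := hT
  classical
  -- Values are forced along the stem; `Set.univ` keeps `A` cofinal at nodes beyond the stem length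
  -- that do not extend the stem in T.
  let A : Node κ → Set (Ord κ) := fun σ =>
    if h : σ.len < ρ.len then {ρ.val ⟨σ.len, h⟩}
    else if ρ ⊆ σ ∧ σ ∈ T then succSet T σ else Set.univ
  have hcof : ∀ σ : Node κ, ρ.len ≤ σ.len → IsCofinal (A σ) := fun σ hσ => by
    simp only [A, dif_neg hσ.not_gt]
    split_ifs with h
    · exact isCofinal_of_mk_eq (hsucc σ h.2 h.1)
    · exact .univ
  have : Nonempty (Ord κ) := ⟨ρ.len⟩
  have hne : ∀ σ, (A σ).Nonempty := fun σ => by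
    by_cases h : σ.len < ρ.len
    · simp only [A, dif_pos h, Set.singleton_nonempty]
    · exact (hcof σ (not_lt.1 h)).nonempty
  obtain ⟨x, hx, hlub⟩ := exists_forall_mem_restrict hκ hunc hS.2.1
    (hS.2.2.2 ▸ Set.subset_union_right) A hne
  have hstem : ∀ b : Set.Iio ρ.len, x b = ρ.val b := fun b => by
    have h := hx b
    have hb : (restrict x b).len < ρ.len := b.2
    simp only [A, dif_pos hb] at h
    exact h
  have hbr : x ∈ branches T := by
    refine mem_branches_of_forall_mem_succSet hT hlim hρ hstem fun c hc hcT => ?_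
    have h := hx c
    have hc' : ¬ (restrict x c).len < ρ.len := not_lt.2 hc
    simp only [A, dif_neg hc'] at h
    rwa [if_pos ⟨subset_restrict_of_forall_eq hc hstem, hcT⟩] at h
  intro hsub
  -- Since ω · `ρ.len` ≥ `ρ.len`, the block with index `ρ.len` lies wholly past the stem.
  refine mem_preimage_blockCode_iff.1 (hsub hbr) ρ.len (hlub ρ.len fun τ hτ => hcof τ ?_)
  exact le_trans (show (ρ.len : Ordinal.{u}) ≤ ω * ρ.len from
    Ordinal.le_mul_right _ omega0_pos) hτ

end Trees

end GenLaver

theorem theorem4p3 (κ : Cardinal.{u}) (hκ : κ.IsRegular) (hunc : ℵ₀ < κ) :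
    (∃ C : Set (GenLaver.Baire κ),
      IsClosed[GenLaver.boundedTopology κ] C ∧
      C ∉ GenLaver.nonDominatingIdeal κ ∧
      ∀ T : Set (GenLaver.Node κ), GenLaver.IsLaverTree T → ¬ GenLaver.branches T ⊆ C) ∧
    (∃ S₀ S₁ : Set (GenLaver.Ord κ), GenLaver.IsStationaryPartition S₀ S₁) ∧
    (∀ S₀ S₁ : Set (GenLaver.Ord κ), GenLaver.IsStationaryPartition S₀ S₁ →
      IsClosed[GenLaver.boundedTopology κ] (GenLaver.blockCode S₁ ⁻¹' {fun _ => 0}) ∧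
      GenLaver.blockCode S₁ ⁻¹' {fun _ => 0} ∉ GenLaver.nonDominatingIdeal κ ∧
      ∀ T : Set (GenLaver.Node κ), GenLaver.IsLaverTree T →
        ¬ GenLaver.branches T ⊆ GenLaver.blockCode S₁ ⁻¹' {fun _ => 0}) := by
  have key := fun (S₀ S₁ : Set (GenLaver.Ord κ)) (hS : GenLaver.IsStationaryPartition S₀ S₁) =>
    And.intro (GenLaver.isClosed_preimage_blockCode hκ hunc S₁)
      (And.intro (not_not_intro (GenLaver.isStronglyDominating_preimage_blockCode hκ hunc hS))
        fun T hT => GenLaver.not_branches_subset_preimage_blockCode hκ hunc (T := T) hS hT)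
  have hex := GenLaver.exists_isStationaryPartition hκ hunc
  obtain ⟨S₀, S₁, hS⟩ := hex
  exact ⟨⟨_, key S₀ S₁ hS⟩, ⟨S₀, S₁, hS⟩, key⟩
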